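/- Let $\mathbb{O}$ be the Cayley numbers (octonions): the formal sums $a=q+Qe$ with $q,Q$ real quaternions, with componentwise addition and Dickson's multiplication $$(q+Qe)(r+Re)=(qr-\overline{R}Q)+(Rq+Q\overline{r})e .$$ Put $\overline{a}=\overline{q}-Qe$ and $N(a)=q\overline{q}+Q\overline{Q}$ (the sum of the squares of the eight real coordinates of $a$), and $a^{-1}=\overline{a}/N(a)$ for $a\neq 0$; let $e_1,e_2$ be the first two imaginary quaternion units. **(A) Algebra.** $\mathbb{O}$ is an alternative field: addition is an abelian group operation, both distributive laws hold, $a(ab)=(aa)b$, $(ba)a=b(aa)$, $a(ba)=(ab)a$ for all $a,b$, there is a unit $1\neq 0$, and each nonzero element has a two-sided inverse. More precisely $a\overline{a}=\overline{a}a=N(a)$ and $N(ab)=N(a)N(b)$ for all $a,b$; and for all $a\ne 0$ and all $b$, $aa^{-1}=a^{-1}a=1$, $a^{-1}(ab)=a(a^{-1}b)=b$ and $(ba)a^{-1}=(ba^{-1})a=b$. Multiplication is not associative: $(e_1e_2)e\neq e_1(e_2e)$. **(B) Incidence.** The coordinate plane over $\mathbb{O}$ has as points the pairs $(x,y)\in\mathbb{O}^2$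 and as lines the equations $x-b=0$ and $y+ax-b=0$ ($a,b\in\mathbb{O}$), two lines being equal when they are of the same type with equal coefficients, and parallel when both are of the first type, or both of the second with the same $a$. It satisfies the plane incidence axioms (two distinct points lie on exactly one line; each line has at least two points; there are three points not on a line) and the parallel postulate (through a point not on a line $g$ there is exactly one line that does not meet $g$). Two distinct lines have no common point if they are parallel and exactly one otherwise. Adjoining one improper point for each class of parallel lines, and one line at infinity consisting of all improper points, gives a projective plane $\Pi$. **(C) Desargues.** In a projective plane consider triangles $\Delta=123$ and $\Delta'=1'2'3'$ with corresponding vertices distinct and corresponding sides distinct. They are *perspective* if the lines through corresponding vertices $11',22',33'$ go through a point, and *axial* if the three intersections of corresponding sides lie on a line. The general Desargues theorem $D_0$ says that all such $\Delta,\Delta'$ are perspective if and only if they are axial. The special theorem $D_2$ says the same of all such $\Delta,\Delta'$ for which (i) each of the triangles has a vertex on a side of the other, or (ii) two different intersections of corresponding sides (that is, for two different pairs of sides) lie respectively on two different lines through corresponding vertices (for two different pairs of vertices), or (iii) one of the triangles has two vertices on sides of the other. (Sides are understood as full lines.) Then $D_2$ holds in $\Pi$, but $D_0$ does not. In particular $D_2$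 does not imply $D_0$ on the basis of the plane (projective) incidence axioms. -/

import Mathlib

/-! ### Cayley numbers by Dickson doubling of the quaternions -/

/-- The Cayley number `q + Q e`, where `q` and `Q` are real quaternions. -/
@[ext]
structure CayleyNumber where
  /-- the quaternion `q` in `q + Q e` -/
  fst : Quaternion ℝ
  /-- the quaternion `Q` in `q + Q e` -/
  snd : Quaternion ℝ

namespace CayleyNumber

noncomputable section

instance : Zero CayleyNumber := ⟨⟨0, 0⟩⟩
instance : One CayleyNumber := ⟨⟨1, 0⟩⟩
instance : Add CayleyNumber := ⟨fun a b => ⟨a.fst + b.fst, a.snd + b.snd⟩⟩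
instance : Neg CayleyNumber := ⟨fun a => ⟨-a.fst, -a.snd⟩⟩
instance : Sub CayleyNumber := ⟨fun a b => ⟨a.fst - b.fst, a.snd - b.snd⟩⟩

/-- `(q + Q e) (r + R e) = (q r - R̄ Q) + (R q + Q r̄) e`. -/
instance : Mul CayleyNumber :=
  ⟨fun a b => ⟨a.fst * b.fst - star b.snd * a.snd, b.snd * a.fst + a.snd * star b.fst⟩⟩

/-- A real number as a Cayley number. -/
def ofReal (t : ℝ) : CayleyNumber := ⟨(t : Quaternion ℝ), 0⟩

/-- The conjugate `q̄ - Q e` of `q + Q e`. -/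
def conj (a : CayleyNumber) : CayleyNumber := ⟨star a.fst, -a.snd⟩

/-- The norm `N(q + Q e) = q q̄ + Q Q̄`, the sum of the squares of the eight real coordinates. -/
def N (a : CayleyNumber) : ℝ := Quaternion.normSq a.fst + Quaternion.normSq a.snd

/-- `a⁻¹ = ā / N(a)`. -/
instance : Inv CayleyNumber := ⟨fun a => ofReal (N a)⁻¹ * conj a⟩

/-- The quaternion unit `e₁`. -/
def e₁ : CayleyNumber := ⟨⟨0, 1, 0, 0⟩, 0⟩

/-- The quaternion unit `e₂`. -/
def e₂ : CayleyNumber := ⟨⟨0, 0, 1, 0⟩, 0⟩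

/-- The adjoined unit `e`. -/
def e : CayleyNumber := ⟨0, 1⟩

end

end CayleyNumber

/-! ### Alternative fields -/

/-- The axioms of an alternative field (alternative division ring). -/
structure IsAlternativeField (K : Type*) [Zero K] [One K] [Add K] [Neg K] [Mul K] : Prop where
  add_assoc : ∀ a b c : K, (a + b) + c = a + (b + c)
  add_comm : ∀ a b : K, a + b = b + a
  add_zero : ∀ a : K, a + 0 = a
  add_neg : ∀ a : K, a + -a = 0
  mul_add : ∀ a b c : K, a * (b + c) = a * b + a * c
  add_mul : ∀ a b c : K, (b + c) * a = b * a + c * a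
  left_alternative : ∀ a b : K, a * (a * b) = (a * a) * b
  right_alternative : ∀ a b : K, (b * a) * a = b * (a * a)
  flexible : ∀ a b : K, a * (b * a) = (a * b) * a
  mul_one : ∀ a : K, a * 1 = a
  one_mul : ∀ a : K, 1 * a = a
  zero_ne_one : (0 : K) ≠ 1
  exists_inv : ∀ a : K, a ≠ 0 → ∃ b : K, a * b = 1 ∧ b * a = 1

/-! ### Plane incidence axioms -/

section Incidence

variable (P L : Type*) [Membership P L]

/-- The plane incidence axioms. -/
structure PlaneIncidenceAxioms : Prop where
  exists_line : ∀ A B : P, A ≠ B → ∃ g : L, A ∈ g ∧ B ∈ g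
  line_unique : ∀ A B : P, A ≠ B → ∀ g h : L, A ∈ g → B ∈ g → A ∈ h → B ∈ h → g = h
  two_points : ∀ g : L, ∃ A B : P, A ≠ B ∧ A ∈ g ∧ B ∈ g
  three_points : ∃ A B C : P, A ≠ B ∧ A ≠ C ∧ B ≠ C ∧ ¬ ∃ g : L, A ∈ g ∧ B ∈ g ∧ C ∈ g

/-- Through a point outside a line there is exactly one line that does not meet it. -/
def ParallelPostulate : Prop :=
  ∀ (g : L) (A : P), A ∉ g → ∃! h : L, A ∈ h ∧ ¬ ∃ B : P, B ∈ g ∧ B ∈ h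

/-! ### Desargues' theorem and its special case -/

/-- A triangle: `side i` is the line through the two vertices other than `vertex i`, and it does
not pass through `vertex i`. -/
structure Triangle where
  vertex : Fin 3 → P
  side : Fin 3 → L
  vertex_mem_side : ∀ i j, i ≠ j → vertex i ∈ side j
  vertex_notMem_side : ∀ i, vertex i ∉ side i

variable {P L}

namespace Triangle

/-- Corresponding vertices are distinct and corresponding sides are distinct, so that in a
projective plane there is exactly one line through corresponding vertices, and corresponding sides
have exactly one intersection. -/
def Admissible (T T' : Triangle P L) : Prop :=
  ∀ i, T.vertex i ≠ T'.vertex i ∧ T.side i ≠ T'.side i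

/-- The lines through corresponding vertices go through a point. -/
def Perspective (T T' : Triangle P L) : Prop :=
  ∃ O : P, ∀ i, ∃ h : L, T.vertex i ∈ h ∧ T'.vertex i ∈ h ∧ O ∈ h

/-- The intersections of corresponding sides lie on a line. -/
def Axial (T T' : Triangle P L) : Prop :=
  ∃ s : L, ∀ i, ∃ Q : P, Q ∈ T.side i ∧ Q ∈ T'.side i ∧ Q ∈ s

/-- `T` has a vertex on a side of `T'`. -/
def HasVertexOnSide (T T' : Triangle P L) : Prop :=
  ∃ i j, T.vertex i ∈ T'.side j

/-- `T` has two vertices on sides of `T'`. -/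
def HasTwoVerticesOnSides (T T' : Triangle P L) : Prop :=
  ∃ i₁ i₂, i₁ ≠ i₂ ∧ (∃ j, T.vertex i₁ ∈ T'.side j) ∧ (∃ j, T.vertex i₂ ∈ T'.side j)

/-- The intersection of the `i`-th sides lies on the line through the `k`-th vertices. -/
def IntersectionOnConnector (T T' : Triangle P L) (i k : Fin 3) : Prop :=
  ∃ (Q : P) (h : L), Q ∈ T.side i ∧ Q ∈ T'.side i ∧ T.vertex k ∈ h ∧ T'.vertex k ∈ h ∧ Q ∈ h

/-- Two intersections of corresponding sides lie on two lines connecting corresponding vertices. -/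
def HasTwoIntersectionsOnConnectors (T T' : Triangle P L) : Prop :=
  ∃ i₁ i₂ k₁ k₂, i₁ ≠ i₂ ∧ k₁ ≠ k₂ ∧
    IntersectionOnConnector T T' i₁ k₁ ∧ IntersectionOnConnector T T' i₂ k₂

end Triangle

variable (P L)

open Triangle in
/-- The general theorem of Desargues `D₀`, in its double form. -/
def DesarguesD0 : Prop :=
  ∀ T T' : Triangle P L, Admissible T T' → (Perspective T T' ↔ Axial T T')

open Triangle in
/-- The special theorem of Desargues `D₂`, in its double form, with its three cases. -/
def DesarguesD2 : Prop :=
  ∀ T T' : Triangle P L, Admissible T T' →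
    ((HasVertexOnSide T T' ∧ HasVertexOnSide T' T) ∨
      HasTwoIntersectionsOnConnectors T T' ∨
      (HasTwoVerticesOnSides T T' ∨ HasTwoVerticesOnSides T' T)) →
    (Perspective T T' ↔ Axial T T')

end Incidence

/-! ### The coordinate plane -/

/-- The lines of the coordinate plane over `K`, whose points are the pairs `(x, y) : K × K`. Two
lines are equal when they are of the same type and have the same coefficients. -/
inductive CoordLine (K : Type*) where
  /-- the line `x - b = 0` -/
  | vertical (b : K)
  /-- the line `y + a x - b = 0` -/
  | sloped (a b : K)

/-- The improper points of the coordinate plane, one for each class of parallel lines. -/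
inductive ImproperPoint (K : Type*) where
  /-- the class of all lines `x - b = 0` -/
  | vertical
  /-- the class of all lines `y + a x - b = 0` with the given `a` -/
  | sloped (a : K)

/-- Incidence in the coordinate plane. -/
instance CoordLine.instMembership (K : Type*) [Zero K] [Add K] [Sub K] [Mul K] :
    Membership (K × K) (CoordLine K) where
  mem g p := match g with
    | .vertical b => p.1 - b = 0
    | .sloped a b => p.2 + a * p.1 - b = 0

/-- The parallel class of a line. -/
def CoordLine.improperPoint {K : Type*} : CoordLine K → ImproperPoint K
  | .vertical _ => .vertical
  | .sloped a _ => .sloped a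

/-- Two lines are parallel when both have the form `x - b = 0`, or both have the form
`y + a x - b = 0` with the same `a`. -/
def CoordLine.Parallel {K : Type*} (g h : CoordLine K) : Prop :=
  g.improperPoint = h.improperPoint

/-- The points of the projective closure of the coordinate plane. -/
inductive ProjPoint (K : Type*) where
  | proper (p : K × K)
  | improper (d : ImproperPoint K)

/-- The lines of the projective closure of the coordinate plane. -/
inductive ProjLine (K : Type*) where
  | ordinary (g : CoordLine K)
  /-- the line at infinity, which consists of all improper points -/
  | atInfinity

/-- Incidence in the projective closure: an improper point lies on exactly the lines of its
parallel class and on the line at infinity. -/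
instance ProjLine.instMembership (K : Type*) [Zero K] [Add K] [Sub K] [Mul K] :
    Membership (ProjPoint K) (ProjLine K) where
  mem l P := match l, P with
    | .ordinary g, .proper p => p ∈ g
    | .ordinary g, .improper d => g.improperPoint = d
    | .atInfinity, .proper _ => False
    | .atInfinity, .improper _ => True

/-! The algebra consists of polynomial identities in the real coordinates. Besides the alternative
laws and the norm theorem, the essential ones are the four of the form `ā(ab) = N(a) b`; as real
factors move freely through products, dividing by `N(a)` gives the four inverse laws. These laws are
all the geometry needs. The left law `a⁻¹(ab) = b` solves `(a - c)x = b - d` for the intersection of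
two lines, and the right law `(u v⁻¹)v = u` gives the line through two points. For `D₂`, the key is
that every flag `O ∈ s` has all its elations (`ProjLine.hasElations`). For the vertical direction on
the line at infinity they are the translations `(x, y) ↦ (x, y + t)`. The maps `(x, y) ↦ (x + s, y +
mx + t)`, `(y, x)` and `(x⁻¹, y x⁻¹)` are collineations by distributivity and the inverse laws, and
they carry every flag to that one; conjugation does the rest. A plane with all elations satisfies
`D₂` because each case supplies an incidence that serves as the flag of a suitable elation. If a
vertex lies on a non-corresponding side, Desargues' theorem holds by incidence alone. Otherwise a
vertex lies on the corresponding side, or an intersection lies on the connector of the opposite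
vertices, and the elation carries one part of the figure to another. A single such incidence
suffices. `D₀` fails because `e₁(e₂e) = -(e₁e₂)e`: two triangles in perspective from the origin have
two pairs of parallel sides, but the sign spoils the third. -/

/-- An alternative division ring, presented by its inverse properties. -/
class AlternativeDivisionRing (K : Type*) extends NonAssocRing K, Inv K, Nontrivial K where
  inv_mul_cancel_left : ∀ a b : K, a ≠ 0 → a⁻¹ * (a * b) = b
  mul_inv_cancel_left : ∀ a b : K, a ≠ 0 → a * (a⁻¹ * b) = b
  mul_inv_cancel_right : ∀ a b : K, a ≠ 0 → (b * a) * a⁻¹ = b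
  inv_mul_cancel_right : ∀ a b : K, a ≠ 0 → (b * a⁻¹) * a = b

namespace AlternativeDivisionRing

variable {K : Type*} [AlternativeDivisionRing K]

theorem mul_inv_self {a : K} (ha : a ≠ 0) : a * a⁻¹ = 1 := by
  simpa using mul_inv_cancel_left a 1 ha

theorem inv_mul_self {a : K} (ha : a ≠ 0) : a⁻¹ * a = 1 := by
  simpa using inv_mul_cancel_left a 1 ha

theorem inv_ne_zero_of_ne_zero {a : K} (ha : a ≠ 0) : a⁻¹ ≠ 0 := by
  intro h
  have := mul_inv_self ha
  simp [h] at this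

theorem inv_inv_of_ne_zero {a : K} (ha : a ≠ 0) : a⁻¹⁻¹ = a := by
  have := inv_mul_cancel_left a⁻¹ a (inv_ne_zero_of_ne_zero ha)
  rwa [inv_mul_self ha, mul_one] at this

end AlternativeDivisionRing

/-! ### Arithmetic of the Cayley numbers -/

namespace CayleyNumber

theorem zero_def : (0 : CayleyNumber) = ⟨0, 0⟩ := rfl
theorem one_def : (1 : CayleyNumber) = ⟨1, 0⟩ := rfl
theorem add_def (a b : CayleyNumber) : a + b = ⟨a.fst + b.fst, a.snd + b.snd⟩ := rfl
theorem neg_def (a : CayleyNumber) : -a = ⟨-a.fst, -a.snd⟩ := rfl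
theorem sub_def (a b : CayleyNumber) : a - b = ⟨a.fst - b.fst, a.snd - b.snd⟩ := rfl
theorem mul_def (a b : CayleyNumber) :
    a * b = ⟨a.fst * b.fst - star b.snd * a.snd, b.snd * a.fst + a.snd * star b.fst⟩ := rfl
theorem inv_def (a : CayleyNumber) : a⁻¹ = ofReal (N a)⁻¹ * conj a := rfl

noncomputable instance : NonAssocRing CayleyNumber where
  add_assoc a b c := by simp only [add_def, add_assoc]
  zero_add a := by simp [add_def, zero_def]
  add_zero a := by simp [add_def, zero_def]
  add_comm a b := by simp only [add_def, add_comm]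
  neg_add_cancel a := by simp [add_def, neg_def, zero_def]
  sub_eq_add_neg a b := by simp [add_def, neg_def, sub_def, sub_eq_add_neg]
  nsmul := nsmulRec
  zsmul := zsmulRec
  left_distrib a b c := by ext1 <;> simp only [add_def, mul_def, star_add] <;> noncomm_ring
  right_distrib a b c := by ext1 <;> simp only [add_def, mul_def] <;> noncomm_ring
  zero_mul a := by simp [mul_def, zero_def]
  mul_zero a := by simp [mul_def, zero_def]
  one_mul a := by simp [mul_def, one_def]
  mul_one a := by simp [mul_def, one_def]

/-! ### Polynomial identities in the real coordinates -/

section Coordinates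

open Quaternion

theorem left_alternative (a b : CayleyNumber) : a * (a * b) = (a * a) * b := by
  ext <;> simp only [
    mul_def, re_sub, imI_sub, imJ_sub, imK_sub, re_add, imI_add, imJ_add, imK_add, re_mul,
    imI_mul, imJ_mul, imK_mul, re_star, imI_star, imJ_star, imK_star] <;> ring

theorem right_alternative (a b : CayleyNumber) : (b * a) * a = b * (a * a) := by
  ext <;> simp only [
    mul_def, re_sub, imI_sub, imJ_sub, imK_sub, re_add, imI_add, imJ_add, imK_add, re_mul,
    imI_mul, imJ_mul, imK_mul, re_star, imI_star, imJ_star, imK_star] <;> ring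

theorem flexible (a b : CayleyNumber) : a * (b * a) = (a * b) * a := by
  ext <;> simp only [
    mul_def, re_sub, imI_sub, imJ_sub, imK_sub, re_add, imI_add, imJ_add, imK_add, re_mul,
    imI_mul, imJ_mul, imK_mul, re_star, imI_star, imJ_star, imK_star] <;> ring

theorem mul_conj_self (a : CayleyNumber) : a * a.conj = ofReal a.N := by
  ext <;> simp only [
    mul_def, conj, ofReal, N, normSq_def', re_sub, imI_sub, imJ_sub, imK_sub, re_add, imI_add,
    imJ_add, imK_add, re_mul, imI_mul, imJ_mul, imK_mul, re_star, imI_star, imJ_star, imK_star,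
    re_neg, imI_neg, imJ_neg, imK_neg, re_coe, imI_coe, imJ_coe, imK_coe, re_zero, imI_zero,
    imJ_zero, imK_zero] <;> ring

theorem conj_mul_self (a : CayleyNumber) : a.conj * a = ofReal a.N := by
  ext <;> simp only [
    mul_def, conj, ofReal, N, normSq_def', re_sub, imI_sub, imJ_sub, imK_sub, re_add, imI_add,
    imJ_add, imK_add, re_mul, imI_mul, imJ_mul, imK_mul, re_star, imI_star, imJ_star, imK_star,
    re_neg, imI_neg, imJ_neg, imK_neg, re_coe, imI_coe, imJ_coe, imK_coe, re_zero, imI_zero,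
    imJ_zero, imK_zero] <;> ring

theorem N_mul (a b : CayleyNumber) : (a * b).N = a.N * b.N := by
  simp only [
    mul_def, N, normSq_def', re_sub, imI_sub, imJ_sub, imK_sub, re_add, imI_add, imJ_add,
    imK_add, re_mul, imI_mul, imJ_mul, imK_mul, re_star, imI_star, imJ_star, imK_star]
  ring

/-- This and the next three identities are the inverse laws with denominators cleared. -/
theorem conj_mul_mul (a b : CayleyNumber) : a.conj * (a * b) = ofReal a.N * b := by
  ext <;> simp only [
    mul_def, conj, ofReal, N, normSq_def', re_sub, imI_sub, imJ_sub, imK_sub, re_add, imI_add,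
    imJ_add, imK_add, re_mul, imI_mul, imJ_mul, imK_mul, re_star, imI_star, imJ_star, imK_star,
    re_neg, imI_neg, imJ_neg, imK_neg, re_coe, imI_coe, imJ_coe, imK_coe, re_zero, imI_zero,
    imJ_zero, imK_zero] <;> ring

theorem mul_conj_mul (a b : CayleyNumber) : a * (a.conj * b) = ofReal a.N * b := by
  ext <;> simp only [
    mul_def, conj, ofReal, N, normSq_def', re_sub, imI_sub, imJ_sub, imK_sub, re_add, imI_add,
    imJ_add, imK_add, re_mul, imI_mul, imJ_mul, imK_mul, re_star, imI_star, imJ_star, imK_star,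
    re_neg, imI_neg, imJ_neg, imK_neg, re_coe, imI_coe, imJ_coe, imK_coe, re_zero, imI_zero,
    imJ_zero, imK_zero] <;> ring

theorem mul_mul_conj (a b : CayleyNumber) : (b * a) * a.conj = ofReal a.N * b := by
  ext <;> simp only [
    mul_def, conj, ofReal, N, normSq_def', re_sub, imI_sub, imJ_sub, imK_sub, re_add, imI_add,
    imJ_add, imK_add, re_mul, imI_mul, imJ_mul, imK_mul, re_star, imI_star, imJ_star, imK_star,
    re_neg, imI_neg, imJ_neg, imK_neg, re_coe, imI_coe, imJ_coe, imK_coe, re_zero, imI_zero,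
    imJ_zero, imK_zero] <;> ring

theorem mul_conj_mul_self (a b : CayleyNumber) : (b * a.conj) * a = ofReal a.N * b := by
  ext <;> simp only [
    mul_def, conj, ofReal, N, normSq_def', re_sub, imI_sub, imJ_sub, imK_sub, re_add, imI_add,
    imJ_add, imK_add, re_mul, imI_mul, imJ_mul, imK_mul, re_star, imI_star, imJ_star, imK_star,
    re_neg, imI_neg, imJ_neg, imK_neg, re_coe, imI_coe, imJ_coe, imK_coe, re_zero, imI_zero,
    imJ_zero, imK_zero] <;> ring

theorem ofReal_mul_mul (t : ℝ) (a b : CayleyNumber) :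
    (ofReal t * a) * b = ofReal t * (a * b) := by
  ext <;> simp [mul_def, ofReal] <;> ring

theorem mul_ofReal_mul (t : ℝ) (a b : CayleyNumber) :
    a * (ofReal t * b) = ofReal t * (a * b) := by
  ext <;> simp [mul_def, ofReal] <;> ring

theorem N_ne_zero {a : CayleyNumber} (ha : a ≠ 0) : a.N ≠ 0 := by
  intro h
  have h₁ := Quaternion.normSq_nonneg (a := a.fst)
  have h₂ := Quaternion.normSq_nonneg (a := a.snd)
  unfold N at h
  refine ha (CayleyNumber.ext ?_ ?_)
  · exact Quaternion.normSq_eq_zero.mp (by linarith)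
  · exact Quaternion.normSq_eq_zero.mp (by linarith)

end Coordinates

theorem ofReal_inv_mul_ofReal_mul {t : ℝ} (ht : t ≠ 0) (b : CayleyNumber) :
    ofReal t⁻¹ * (ofReal t * b) = b := by
  rw [← ofReal_mul_mul]
  have : ofReal t⁻¹ * ofReal t = 1 := by
    rw [mul_def]
    simp only [ofReal, one_def, ← Quaternion.coe_mul, inv_mul_cancel₀ ht]
    simp
  rw [this, one_mul]

noncomputable instance : AlternativeDivisionRing CayleyNumber where
  exists_pair_ne := ⟨0, 1, fun h => by simp [zero_def, one_def] at h⟩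
  inv_mul_cancel_left a b ha := by
    rw [inv_def, ofReal_mul_mul, conj_mul_mul, ofReal_inv_mul_ofReal_mul (N_ne_zero ha)]
  mul_inv_cancel_left a b ha := by
    rw [inv_def, ofReal_mul_mul, mul_ofReal_mul, mul_conj_mul,
      ofReal_inv_mul_ofReal_mul (N_ne_zero ha)]
  mul_inv_cancel_right a b ha := by
    rw [inv_def, mul_ofReal_mul, mul_mul_conj, ofReal_inv_mul_ofReal_mul (N_ne_zero ha)]
  inv_mul_cancel_right a b ha := by
    rw [inv_def, mul_ofReal_mul, ofReal_mul_mul, mul_conj_mul_self,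
      ofReal_inv_mul_ofReal_mul (N_ne_zero ha)]

theorem isAlternativeField : IsAlternativeField CayleyNumber :=
  ⟨add_assoc, add_comm, add_zero, add_neg_cancel, mul_add, fun a b c => add_mul b c a,
    left_alternative, right_alternative, flexible, mul_one, one_mul, zero_ne_one,
    fun a ha => ⟨a⁻¹, AlternativeDivisionRing.mul_inv_self ha,
      AlternativeDivisionRing.inv_mul_self ha⟩⟩

@[simp] theorem e₁_fst_re : e₁.fst.re = 0 := rfl
@[simp] theorem e₁_fst_imI : e₁.fst.imI = 1 := rfl
@[simp] theorem e₁_fst_imJ : e₁.fst.imJ = 0 := rfl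
@[simp] theorem e₁_fst_imK : e₁.fst.imK = 0 := rfl
@[simp] theorem e₂_fst_re : e₂.fst.re = 0 := rfl
@[simp] theorem e₂_fst_imI : e₂.fst.imI = 0 := rfl
@[simp] theorem e₂_fst_imJ : e₂.fst.imJ = 1 := rfl
@[simp] theorem e₂_fst_imK : e₂.fst.imK = 0 := rfl
@[simp] theorem e₁_snd : e₁.snd = 0 := rfl
@[simp] theorem e₂_snd : e₂.snd = 0 := rfl
@[simp] theorem e_fst : e.fst = 0 := rfl
@[simp] theorem e_snd : e.snd = 1 := rfl
@[simp] theorem fst_zero : (0 : CayleyNumber).fst = 0 := rfl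
@[simp] theorem snd_zero : (0 : CayleyNumber).snd = 0 := rfl
@[simp] theorem fst_one : (1 : CayleyNumber).fst = 1 := rfl
@[simp] theorem snd_one : (1 : CayleyNumber).snd = 0 := rfl
@[simp] theorem fst_add (a b : CayleyNumber) : (a + b).fst = a.fst + b.fst := rfl
@[simp] theorem snd_add (a b : CayleyNumber) : (a + b).snd = a.snd + b.snd := rfl
@[simp] theorem fst_sub (a b : CayleyNumber) : (a - b).fst = a.fst - b.fst := rfl
@[simp] theorem snd_sub (a b : CayleyNumber) : (a - b).snd = a.snd - b.snd := rfl
@[simp] theorem fst_neg (a : CayleyNumber) : (-a).fst = -a.fst := rfl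
@[simp] theorem snd_neg (a : CayleyNumber) : (-a).snd = -a.snd := rfl
@[simp] theorem fst_mul (a b : CayleyNumber) :
    (a * b).fst = a.fst * b.fst - star b.snd * a.snd := rfl
@[simp] theorem snd_mul (a b : CayleyNumber) :
    (a * b).snd = b.snd * a.fst + a.snd * star b.fst := rfl

/-- Dickson's rule gives `q(Re) = (Rq)e`, so the left side is `(e₂e₁)e`, and `e₁`, `e₂` anticommute.
This sign yields both non-associativity and the counterexample to `D₀`. -/
theorem e₁_mul_e₂_mul_e : e₁ * (e₂ * e) = -((e₁ * e₂) * e) := by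
  ext <;> simp

theorem e₁_mul_e₂_mul_e_ne : (e₁ * e₂) * e ≠ e₁ * (e₂ * e) := by
  intro h
  have := congrArg (fun a => a.snd.imK) h
  simp at this
  norm_num at this

end CayleyNumber

/-! ### Collineations and elations -/

/-- A collineation of an incidence structure. -/
structure Collineation (P L : Type*) [Membership P L] where
  point : P ≃ P
  line : L ≃ L
  mem_iff : ∀ p l, point p ∈ line l ↔ p ∈ l

namespace Collineation

variable {P L : Type*} [Membership P L]

/-- The inverse collineation. -/
def symm (φ : Collineation P L) : Collineation P L where
  point := φ.point.symm
  line := φ.line.symm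
  mem_iff p l := by rw [← φ.mem_iff, Equiv.apply_symm_apply, Equiv.apply_symm_apply]

/-- The composition of two collineations, the left one applied first. -/
def trans (φ ψ : Collineation P L) : Collineation P L where
  point := φ.point.trans ψ.point
  line := φ.line.trans ψ.line
  mem_iff p l := by simp [φ.mem_iff, ψ.mem_iff]

/-- A pair of involutions that preserves incidence is a collineation. -/
def ofInvolutive (f : P → P) (g : L → L) (hf : Function.Involutive f)
    (hg : Function.Involutive g) (h : ∀ p l, p ∈ l → f p ∈ g l) : Collineation P L where
  point := hf.toPerm
  line := hg.toPerm
  mem_iff p l := ⟨fun hp => by simpa [hf p, hg l] using h _ _ hp, h p l⟩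

theorem mem (φ : Collineation P L) {p : P} {l : L} (h : p ∈ l) : φ.point p ∈ φ.line l :=
  (φ.mem_iff p l).mpr h

end Collineation

/-- For any two points off `s` on a line through `O`, some collineation with centre `O` and
axis `s` maps the first to the second. -/
def HasElations {P L : Type*} [Membership P L] (O : P) (s : L) : Prop :=
  ∀ (A A' : P) (c : L), A ∉ s → A' ∉ s → O ∈ c → A ∈ c → A' ∈ c →
    ∃ φ : Collineation P L, (∀ X ∈ s, φ.point X = X) ∧ (∀ g, O ∈ g → φ.line g = g) ∧
      φ.point A = A'

/-- Conjugating by `φ` turns an elation of the image flag into one of the original flag. -/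
theorem HasElations.of_map {P L : Type*} [Membership P L] {O : P} {s : L}
    (φ : Collineation P L) (h : HasElations (φ.point O) (φ.line s)) : HasElations O s := by
  intro A A' c hA hA' hO hAc hAc'
  obtain ⟨ψ, h₁, h₂, h₃⟩ := h (φ.point A) (φ.point A') (φ.line c) (by rwa [φ.mem_iff])
    (by rwa [φ.mem_iff]) (φ.mem hO) (φ.mem hAc) (φ.mem hAc')
  refine ⟨(φ.trans ψ).trans φ.symm, fun X hX => ?_, fun g hg => ?_, ?_⟩
  · simp [Collineation.trans, Collineation.symm, h₁ _ (φ.mem hX)]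
  · simp [Collineation.trans, Collineation.symm, h₂ _ (φ.mem hg)]
  · simp [Collineation.trans, Collineation.symm, h₃]

/-! ### Desargues' theorem with one additional incidence -/

section Desargues

open Configuration Triangle

theorem Fin.exists_others_three (i : Fin 3) :
    ∃ j k : Fin 3, i ≠ j ∧ i ≠ k ∧ j ≠ k ∧ ∀ l, l = i ∨ l = j ∨ l = k := by
  revert i; decide

theorem Fin.exists_third {i j : Fin 3} (h : i ≠ j) :
    ∃ k : Fin 3, i ≠ k ∧ j ≠ k ∧ ∀ l, l = i ∨ l = j ∨ l = k := by
  revert i j; decide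

variable {P L : Type*} [Membership P L]

/-! ### Connectors and intersections of a pair of triangles -/

namespace Triangle

variable {T T' : Triangle P L}

theorem vertex_ne (T : Triangle P L) {i j : Fin 3} (h : i ≠ j) : T.vertex i ≠ T.vertex j :=
  fun e => T.vertex_notMem_side j (e ▸ T.vertex_mem_side i j h)

theorem side_ne (T : Triangle P L) {i j : Fin 3} (h : i ≠ j) : T.side i ≠ T.side j :=
  fun e => T.vertex_notMem_side i (e ▸ T.vertex_mem_side i j h)

theorem Admissible.symm (h : Admissible T T') : Admissible T' T :=
  fun i => ⟨(h i).1.symm, (h i).2.symm⟩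

theorem Perspective.symm : Perspective T T' → Perspective T' T := fun ⟨O, h⟩ =>
  ⟨O, fun i => let ⟨g, h₁, h₂, h₃⟩ := h i; ⟨g, h₂, h₁, h₃⟩⟩

theorem Axial.symm : Axial T T' → Axial T' T := fun ⟨s, h⟩ =>
  ⟨s, fun i => let ⟨g, h₁, h₂, h₃⟩ := h i; ⟨g, h₂, h₁, h₃⟩⟩

end Triangle

variable [ProjectivePlane P L]

theorem Configuration.line_eq {X Y : P} {g h : L} (hne : X ≠ Y) (h₁ : X ∈ g) (h₂ : Y ∈ g)
    (h₃ : X ∈ h) (h₄ : Y ∈ h) : g = h :=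
  (Nondegenerate.eq_or_eq h₁ h₂ h₃ h₄).resolve_left hne

theorem Configuration.point_eq {X Y : P} {g h : L} (hne : g ≠ h) (h₁ : X ∈ g) (h₂ : X ∈ h)
    (h₃ : Y ∈ g) (h₄ : Y ∈ h) : X = Y :=
  (Nondegenerate.eq_or_eq h₁ h₃ h₂ h₄).resolve_right hne

theorem Configuration.exists_line_through {X Y : P} (h : X ≠ Y) : ∃ g : L, X ∈ g ∧ Y ∈ g :=
  ⟨HasLines.mkLine h, HasLines.mkLine_ax h⟩

theorem Configuration.exists_common_point {g h : L} (hne : g ≠ h) : ∃ X : P, X ∈ g ∧ X ∈ h :=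
  ⟨HasPoints.mkPoint hne, HasPoints.mkPoint_ax hne⟩

variable {T T' : Triangle P L} {c : Fin 3 → L} {Q : Fin 3 → P}

/-- Corresponding vertices are distinct, so the lines in `Perspective` must be the chosen connectors
`c i`. `Axial.exists_axis` is the dual. -/
theorem Triangle.Perspective.exists_center (h : Admissible T T')
    (hA : ∀ i, T.vertex i ∈ c i) (hB : ∀ i, T'.vertex i ∈ c i) (hp : Perspective T T') :
    ∃ O, ∀ i, O ∈ c i := by
  obtain ⟨O, hO⟩ := hp
  refine ⟨O, fun i => ?_⟩
  obtain ⟨g, h₁, h₂, h₃⟩ := hO i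
  rwa [line_eq (h i).1 (hA i) (hB i) h₁ h₂]

theorem Triangle.Axial.exists_axis (h : Admissible T T')
    (ha : ∀ i, Q i ∈ T.side i) (hb : ∀ i, Q i ∈ T'.side i) (hp : Axial T T') :
    ∃ s : L, ∀ i, Q i ∈ s := by
  obtain ⟨s, hs⟩ := hp
  refine ⟨s, fun i => ?_⟩
  obtain ⟨R, h₁, h₂, h₃⟩ := hs i
  rwa [point_eq (h i).2 (ha i) (hb i) h₁ h₂]

/-- A common connector of two vertex pairs would be the third side of both triangles.
`intersection_ne` is the dual. -/
theorem Triangle.Admissible.connector_ne (h : Admissible T T')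
    (hA : ∀ i, T.vertex i ∈ c i) (hB : ∀ i, T'.vertex i ∈ c i) {i j : Fin 3} (hij : i ≠ j) :
    c i ≠ c j := by
  intro e
  obtain ⟨k, hik, hjk, -⟩ := Fin.exists_third hij
  have h₁ : c i = T.side k := line_eq (T.vertex_ne hij) (hA i) (e ▸ hA j)
    (T.vertex_mem_side _ _ hik) (T.vertex_mem_side _ _ hjk)
  have h₂ : c i = T'.side k := line_eq (T'.vertex_ne hij) (hB i) (e ▸ hB j)
    (T'.vertex_mem_side _ _ hik) (T'.vertex_mem_side _ _ hjk)
  exact (h k).2 (h₁ ▸ h₂)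

theorem Triangle.Admissible.intersection_ne (h : Admissible T T')
    (ha : ∀ i, Q i ∈ T.side i) (hb : ∀ i, Q i ∈ T'.side i) {i j : Fin 3} (hij : i ≠ j) :
    Q i ≠ Q j := by
  intro e
  obtain ⟨k, hik, hjk, -⟩ := Fin.exists_third hij
  have h₁ : Q i = T.vertex k := point_eq (T.side_ne hij) (ha i) (e ▸ ha j)
    (T.vertex_mem_side _ _ hik.symm) (T.vertex_mem_side _ _ hjk.symm)
  have h₂ : Q i = T'.vertex k := point_eq (T'.side_ne hij) (hb i) (e ▸ hb j)
    (T'.vertex_mem_side _ _ hik.symm) (T'.vertex_mem_side _ _ hjk.symm)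
  exact (h k).1 (h₁ ▸ h₂)

theorem Triangle.Admissible.exists_connectors (h : Admissible T T') :
    ∃ c : Fin 3 → L, (∀ i, T.vertex i ∈ c i) ∧ ∀ i, T'.vertex i ∈ c i := by
  choose c hA hB using fun i => exists_line_through (L := L) (h i).1
  exact ⟨c, hA, hB⟩

theorem Triangle.Admissible.exists_intersections (h : Admissible T T') :
    ∃ Q : Fin 3 → P, (∀ i, Q i ∈ T.side i) ∧ ∀ i, Q i ∈ T'.side i := by
  choose Q ha hb using fun i => exists_common_point (P := P) (h i).2
  exact ⟨Q, ha, hb⟩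

/-- Desargues' theorem when a vertex lies on a side that is not the corresponding one. -/
theorem Triangle.Admissible.perspective_iff_axial_of_mem_adjacent (h : Admissible T T')
    {i j : Fin 3} (hij : i ≠ j) (hv : T.vertex i ∈ T'.side j) :
    Perspective T T' ↔ Axial T T' := by
  obtain ⟨c, hA, hB⟩ := h.exists_connectors
  obtain ⟨Q, ha, hb⟩ := h.exists_intersections
  obtain ⟨k, hik, hjk, hall⟩ := Fin.exists_third hij
  have hA' := T.vertex_mem_side
  have hB' := T'.vertex_mem_side
  constructor
  · intro hp
    obtain ⟨O, hO⟩ := hp.exists_center h hA hB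
    have hci : c i = T'.side j := line_eq (h i).1 (hA i) (hB i) hv (hB' _ _ hij)
    -- Both `O` and `T'.vertex k` lie on `c k` and on `c i = T'.side j`. The centre is therefore a
    -- vertex of `T'`, which puts `T.vertex j` on `T'.side i` and makes `T.side k` the axis.
    have hOk : O = T'.vertex k := by
      by_contra hne
      exact h.connector_ne hA hB hik (hci.trans
        (line_eq hne (hO k) (hB k) (hci ▸ hO i) (hB' _ _ hjk.symm)).symm)
    have hcj : c j = T'.side i := line_eq (T'.vertex_ne hjk) (hB j) (hOk ▸ hO j)
      (hB' _ _ hij.symm) (hB' _ _ hik.symm)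
    refine ⟨T.side k, fun l => ?_⟩
    rcases hall l with rfl | rfl | rfl
    · exact ⟨T.vertex j, hA' _ _ hij.symm, hcj ▸ hA j, hA' _ _ hjk⟩
    · exact ⟨T.vertex i, hA' _ _ hij, hv, hA' _ _ hik⟩
    · exact ⟨Q l, ha l, hb l, ha l⟩
  · intro hp
    obtain ⟨s, hs⟩ := hp.exists_axis h ha hb
    -- The axis must be `T.side k`, so `Q i` and `Q j` are vertices of `T`. This makes `T'.vertex k`
    -- the centre.
    have hQj : Q j = T.vertex i := point_eq (h j).2 (ha j) (hb j) (hA' _ _ hij) hv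
    have hsk : s = T.side k := line_eq (h.intersection_ne ha hb hjk) (hs j) (hs k)
      (hQj ▸ hA' _ _ hik) (ha k)
    have hQi : Q i = T.vertex j := point_eq (T.side_ne hik) (ha i) (hsk ▸ hs i)
      (hA' _ _ hij.symm) (hA' _ _ hjk)
    refine ⟨T'.vertex k, fun l => ?_⟩
    rcases hall l with rfl | rfl | rfl
    · exact ⟨T'.side j, hv, hB' _ _ hij, hB' _ _ hjk.symm⟩
    · exact ⟨T'.side i, hQi ▸ hb i, hB' _ _ hij.symm, hB' _ _ hik.symm⟩
    · exact ⟨c l, hA l, hB l, hB l⟩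

/-- If `O` were on `T.side i`, each connector `c l` with `l ≠ i` would meet that side in both `O`
and `T.vertex l`. Since `c l` is not that side, `O` would equal two different vertices. -/
theorem Triangle.center_notMem_side
    (hA : ∀ i, T.vertex i ∈ c i) (hB : ∀ i, T'.vertex i ∈ c i)
    (hnd : ∀ i j, i ≠ j → T'.vertex i ∉ T.side j) {O : P} (hO : ∀ i, O ∈ c i) (i : Fin 3) :
    O ∉ T.side i := by
  intro hOi
  obtain ⟨j, k, hij, hik, hjk, -⟩ := Fin.exists_others_three i
  have key : ∀ l, i ≠ l → O = T.vertex l := by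
    intro l hl
    by_contra hne
    have : c l = T.side i := line_eq hne (hO l) (hA l) hOi (T.vertex_mem_side _ _ hl.symm)
    exact hnd l i hl.symm (this ▸ hB l)
  exact T.vertex_ne hjk ((key j hij).symm.trans (key k hik))

/-- Desargues' theorem when a vertex lies on the corresponding side of the other triangle. -/
theorem Triangle.Admissible.perspective_iff_axial_of_mem_opposite (h : Admissible T T')
    (hel : ∀ (O : P) (s : L), O ∈ s → HasElations O s)
    (hndA : ∀ i j, i ≠ j → T.vertex i ∉ T'.side j)
    (hndB : ∀ i j, i ≠ j → T'.vertex i ∉ T.side j)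
    {i : Fin 3} (hv : T.vertex i ∈ T'.side i) :
    Perspective T T' ↔ Axial T T' := by
  obtain ⟨c, hA, hB⟩ := h.exists_connectors
  obtain ⟨Q, ha, hb⟩ := h.exists_intersections
  obtain ⟨j, k, hij, hik, hjk, hall⟩ := Fin.exists_others_three i
  have hA' := T.vertex_mem_side
  have hB' := T'.vertex_mem_side
  constructor
  · intro hp
    obtain ⟨O, hO⟩ := hp.exists_center h hA hB
    have hOa := center_notMem_side hA hB hndB hO
    have hOb := center_notMem_side hB hA hndA hO
    -- The elation with centre `T.vertex i` and axis `T'.side i` that sends `T'.vertex i` to `O`. It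
    -- turns the other two sides of `T'` into connectors and fixes those of `T`, so it sends `Q j`,
    -- `Q k` to `T.vertex k`, `T.vertex j`.
    obtain ⟨φ, hfix, hline, hφ⟩ := hel _ _ hv (T'.vertex i) O (c i) (T'.vertex_notMem_side i)
      (hOb i) (hA i) (hB i) (hO i)
    have key : ∀ j k, i ≠ j → i ≠ k → j ≠ k → φ.point (Q j) = T.vertex k := by
      intro j k hij hik hjk
      have h₁ : φ.line (T'.side j) = c k :=
        line_eq (by intro e; exact hOb i (e ▸ hB' _ _ hik.symm)) (hφ ▸ φ.mem (hB' _ _ hij))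
          (hfix _ (hB' _ _ hik.symm) ▸ φ.mem (hB' _ _ hjk.symm)) (hO k) (hB k)
      have h₂ : φ.line (T.side j) = T.side j := hline _ (hA' _ _ hij)
      exact point_eq (by intro e; exact hOa j (e ▸ hO k)) (h₂ ▸ φ.mem (ha j)) (h₁ ▸ φ.mem (hb j))
        (hA' _ _ hjk.symm) (hA k)
    obtain ⟨s, hsj, hsk⟩ := exists_line_through (L := L) (h.intersection_ne ha hb hjk)
    have hs : φ.line s = T.side i := line_eq (T.vertex_ne hjk)
      (key k j hik hij hjk.symm ▸ φ.mem hsk) (key j k hij hik hjk ▸ φ.mem hsj)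
      (hA' _ _ hij.symm) (hA' _ _ hik.symm)
    -- `Q i` is on the axis, hence fixed, and it lies on the image `T.side i` of `s`.
    have hsi : Q i ∈ s := by
      rw [← φ.mem_iff, hs, hfix _ (hb i)]
      exact ha i
    refine ⟨s, fun l => ⟨Q l, ha l, hb l, ?_⟩⟩
    rcases hall l with rfl | rfl | rfl <;> assumption
  · intro hp
    obtain ⟨s, hs⟩ := hp.exists_axis h ha hb
    obtain ⟨O, hOi, hOj⟩ := exists_common_point (P := P) (h.connector_ne hA hB hij)
    have hOb : O ∉ T'.side i := by
      intro hO
      have h₁ : O = T'.vertex j := point_eq (by intro e; exact hndA j i hij.symm (e ▸ hA j)) hOj hO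
        (hB j) (hB' _ _ hij.symm)
      have h₂ : c i = T'.side k := line_eq (T'.vertex_ne hij) (hB i) (h₁ ▸ hOi)
        (hB' _ _ hik) (hB' _ _ hjk)
      exact hndA i k hik (h₂ ▸ hA i)
    -- The same elation, with `O` now the intersection of two connectors. The axis `s` is carried to
    -- `T.side i`, which identifies the image of `T'.side j` as the third connector; that image
    -- contains `O`.
    obtain ⟨φ, hfix, hline, hφ⟩ := hel _ _ hv (T'.vertex i) O (c i) (T'.vertex_notMem_side i)
      hOb (hA i) (hB i) hOi
    have h₁ : φ.line (T'.side k) = c j :=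
      line_eq (by intro e; exact hOb (e ▸ hB' _ _ hij.symm)) (hφ ▸ φ.mem (hB' _ _ hik))
        (hfix _ (hB' _ _ hij.symm) ▸ φ.mem (hB' _ _ hjk)) hOj (hB j)
    have h₂ : φ.point (Q k) = T.vertex j :=
      point_eq (by intro e; exact hndB j k hjk (e ▸ hB j)) (hline _ (hA' _ _ hik) ▸ φ.mem (ha k))
        (h₁ ▸ φ.mem (hb k)) (hA' _ _ hjk) (hA j)
    have h₃ : φ.line s = T.side i :=
      line_eq (by intro e; exact hndA j i hij.symm (e ▸ hb i)) (h₂ ▸ φ.mem (hs k))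
        (hfix _ (hb i) ▸ φ.mem (hs i)) (hA' _ _ hij.symm) (ha i)
    have h₄ : φ.point (Q j) = T.vertex k :=
      point_eq (T.side_ne hij) (h₃ ▸ φ.mem (hs j)) (hline _ (hA' _ _ hij) ▸ φ.mem (ha j))
        (hA' _ _ hik.symm) (hA' _ _ hjk.symm)
    have h₅ : φ.line (T'.side j) = c k :=
      line_eq (h k).1 (h₄ ▸ φ.mem (hb j))
        (hfix _ (hB' _ _ hik.symm) ▸ φ.mem (hB' _ _ hjk.symm)) (hA k) (hB k)
    have hOk : O ∈ c k := by
      rw [← h₅, ← hφ]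
      exact φ.mem (hB' _ _ hij)
    refine ⟨O, fun l => ⟨c l, hA l, hB l, ?_⟩⟩
    rcases hall l with rfl | rfl | rfl <;> assumption

/-- Desargues' theorem when the intersection of two corresponding sides lies on the line through
the opposite vertices. -/
theorem Triangle.Admissible.perspective_iff_axial_of_intersectionOnConnector
    (h : Admissible T T') (hel : ∀ (O : P) (s : L), O ∈ s → HasElations O s)
    (hndA : ∀ i j, i ≠ j → T.vertex i ∉ T'.side j)
    (hndB : ∀ i j, i ≠ j → T'.vertex i ∉ T.side j)
    {i : Fin 3} (hv : IntersectionOnConnector T T' i i) :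
    Perspective T T' ↔ Axial T T' := by
  obtain ⟨c, hA, hB⟩ := h.exists_connectors
  obtain ⟨Q, ha, hb⟩ := h.exists_intersections
  obtain ⟨j, k, hij, hik, hjk, hall⟩ := Fin.exists_others_three i
  have hA' := T.vertex_mem_side
  have hB' := T'.vertex_mem_side
  have hQc : Q i ∈ c i := by
    obtain ⟨R, g, h₁, h₂, h₃, h₄, h₅⟩ := hv
    rwa [point_eq (h i).2 (ha i) (hb i) h₁ h₂, line_eq (h i).1 (hA i) (hB i) h₃ h₄]
  have hAc : ∀ j, i ≠ j → T.vertex j ∉ c i := by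
    intro j hij hj
    obtain ⟨k, hik, hjk, -⟩ := Fin.exists_third hij
    have : c i = T.side k := line_eq (T.vertex_ne hij) (hA i) hj (hA' _ _ hik) (hA' _ _ hjk)
    exact hndB i k hik (this ▸ hB i)
  -- The elation with centre `Q i` and axis `c i` that sends `T.vertex j` to `T.vertex k`. In both
  -- directions it turns out to send `T'.vertex j` to `T'.vertex k` and `Q k` to `Q j`, while lines
  -- through `Q i` and points of `c i` stay fixed.
  obtain ⟨φ, hfix, hline, hφ⟩ := hel _ _ hQc (T.vertex j) (T.vertex k) (T.side i)
    (hAc j hij) (hAc k hik) (ha i) (hA' _ _ hij.symm) (hA' _ _ hik.symm)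
  have hφa : φ.line (T.side k) = T.side j :=
    line_eq (T.vertex_ne hik) (hfix _ (hA i) ▸ φ.mem (hA' _ _ hik)) (hφ ▸ φ.mem (hA' _ _ hjk))
      (hA' _ _ hij) (hA' _ _ hjk.symm)
  have hφb : φ.line (T'.side i) = T'.side i := hline _ (hb i)
  constructor
  · intro hp
    obtain ⟨O, hO⟩ := hp.exists_center h hA hB
    have hOa := center_notMem_side hA hB hndB hO
    have h₁ : φ.line (c j) = c k :=
      line_eq (by intro e; exact hOa i (e ▸ hA' _ _ hik.symm)) (hfix _ (hO i) ▸ φ.mem (hO j))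
        (hφ ▸ φ.mem (hA j)) (hO k) (hA k)
    have h₂ : φ.point (T'.vertex j) = T'.vertex k :=
      point_eq (by intro e; exact hndA k i hik.symm (e ▸ hA k)) (h₁ ▸ φ.mem (hB j))
        (hφb ▸ φ.mem (hB' _ _ hij.symm)) (hB k) (hB' _ _ hik.symm)
    have h₃ : φ.line (T'.side k) = T'.side j :=
      line_eq (T'.vertex_ne hik) (hfix _ (hB i) ▸ φ.mem (hB' _ _ hik))
        (h₂ ▸ φ.mem (hB' _ _ hjk)) (hB' _ _ hij) (hB' _ _ hjk.symm)
    obtain ⟨s, hsi, hsk⟩ := exists_line_through (L := L) (h.intersection_ne ha hb hik)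
    refine ⟨s, fun l => ?_⟩
    rcases hall l with rfl | rfl | rfl
    · exact ⟨Q l, ha l, hb l, hsi⟩
    · exact ⟨φ.point (Q k), hφa ▸ φ.mem (ha k), h₃ ▸ φ.mem (hb k), hline s hsi ▸ φ.mem hsk⟩
    · exact ⟨Q l, ha l, hb l, hsk⟩
  · intro hp
    obtain ⟨s, hs⟩ := hp.exists_axis h ha hb
    obtain ⟨O, hOi, hOj⟩ := exists_common_point (P := P) (h.connector_ne hA hB hij)
    have hsa : s ≠ T.side j := by
      intro e
      have : Q k = T.vertex i := point_eq (T.side_ne hjk) (e ▸ hs k) (ha k)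
        (hA' _ _ hij) (hA' _ _ hik)
      exact hndA i k hik (this ▸ hb k)
    have h₁ : φ.point (Q k) = Q j :=
      point_eq hsa (hline s (hs i) ▸ φ.mem (hs k)) (hφa ▸ φ.mem (ha k)) (hs j) (ha j)
    have h₂ : φ.line (T'.side k) = T'.side j :=
      line_eq (by intro e; exact hndB i j hij (e ▸ ha j)) (hfix _ (hB i) ▸ φ.mem (hB' _ _ hik))
        (h₁ ▸ φ.mem (hb k)) (hB' _ _ hij) (hb j)
    have h₃ : φ.point (T'.vertex j) = T'.vertex k :=
      point_eq (T'.side_ne hij) (hφb ▸ φ.mem (hB' _ _ hij.symm)) (h₂ ▸ φ.mem (hB' _ _ hjk))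
        (hB' _ _ hik.symm) (hB' _ _ hjk.symm)
    have h₄ : φ.line (c j) = c k :=
      line_eq (h k).1 (hφ ▸ φ.mem (hA j)) (h₃ ▸ φ.mem (hB j)) (hA k) (hB k)
    have hOk : O ∈ c k := by
      rw [← h₄, ← hfix O hOi]
      exact φ.mem hOj
    refine ⟨O, fun l => ⟨c l, hA l, hB l, ?_⟩⟩
    rcases hall l with rfl | rfl | rfl <;> assumption

/-- A projective plane with all elations satisfies the special theorem of Desargues. -/
theorem desarguesD2_of_hasElations (hel : ∀ (O : P) (s : L), O ∈ s → HasElations O s) :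
    DesarguesD2 P L := by
  intro T T' h hcase
  by_cases hndA : ∃ i j, i ≠ j ∧ T.vertex i ∈ T'.side j
  · obtain ⟨i, j, hij, hv⟩ := hndA
    exact h.perspective_iff_axial_of_mem_adjacent hij hv
  by_cases hndB : ∃ i j, i ≠ j ∧ T'.vertex i ∈ T.side j
  · obtain ⟨i, j, hij, hv⟩ := hndB
    have := h.symm.perspective_iff_axial_of_mem_adjacent hij hv
    exact ⟨fun hp => (this.mp hp.symm).symm, fun hp => (this.mpr hp.symm).symm⟩
  push Not at hndA hndB
  have hT : HasVertexOnSide T T' → (Perspective T T' ↔ Axial T T') := by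
    rintro ⟨i, j, hv⟩
    obtain rfl : i = j := by
      by_contra hij
      exact hndA i j hij hv
    exact h.perspective_iff_axial_of_mem_opposite hel hndA hndB hv
  have hT' : HasVertexOnSide T' T → (Perspective T T' ↔ Axial T T') := by
    rintro ⟨i, j, hv⟩
    obtain rfl : i = j := by
      by_contra hij
      exact hndB i j hij hv
    have := h.symm.perspective_iff_axial_of_mem_opposite hel hndB hndA hv
    exact ⟨fun hp => (this.mp hp.symm).symm, fun hp => (this.mpr hp.symm).symm⟩
  rcases hcase with ⟨hv, -⟩ | ⟨i, -, k, -, -, -, hv, -⟩ | ⟨i, -, -, ⟨j, hv⟩, -⟩ | ⟨i, -, -, ⟨j, hv⟩, -⟩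
  · exact hT hv
  -- For `i ≠ k` the vertex `T.vertex k` is on `T.side i`. Then the intersection is that vertex or
  -- the connector is that side, and either way a vertex lies on a non-corresponding side.
  · obtain rfl : i = k := by
      by_contra hik
      obtain ⟨R, g, h₁, h₂, h₃, h₄, h₅⟩ := hv
      by_cases hR : R = T.vertex k
      · exact hndA k i (Ne.symm hik) (hR ▸ h₂)
      · have := line_eq hR h₅ h₃ h₁ (T.vertex_mem_side k i (Ne.symm hik))
        exact hndB k i (Ne.symm hik) (this ▸ h₄)
    exact h.perspective_iff_axial_of_intersectionOnConnector hel hndA hndB hv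
  · exact hT ⟨i, j, hv⟩
  · exact hT' ⟨i, j, hv⟩

end Desargues

/-! ### The coordinate plane over an alternative division ring -/

open AlternativeDivisionRing

namespace AlternativeDivisionRing

variable {K : Type*} [AlternativeDivisionRing K]

instance : NoZeroDivisors K where
  eq_zero_or_eq_zero_of_mul_eq_zero {a b} h := by
    by_contra! hab
    exact hab.2 (by rw [← inv_mul_cancel_left a b hab.1, h, mul_zero])

end AlternativeDivisionRing

namespace CoordLine

variable {K : Type*} [AlternativeDivisionRing K]

theorem mem_vertical {p : K × K} {b : K} : p ∈ vertical b ↔ p.1 = b :=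
  Iff.trans Iff.rfl sub_eq_zero

theorem mem_sloped {p : K × K} {a b : K} : p ∈ sloped a b ↔ p.2 + a * p.1 = b :=
  Iff.trans Iff.rfl sub_eq_zero

theorem existsUnique_mem_vertical_sloped (b a c : K) :
    ∃! p : K × K, p ∈ vertical b ∧ p ∈ sloped a c := by
  simp only [mem_vertical, mem_sloped]
  refine ⟨(b, c - a * b), ⟨rfl, sub_add_cancel _ _⟩, ?_⟩
  rintro ⟨x, y⟩ ⟨rfl, rfl⟩
  simp

theorem existsUnique_mem_sloped_sloped {a c : K} (h : a ≠ c) (b d : K) :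
    ∃! p : K × K, p ∈ sloped a b ∧ p ∈ sloped c d := by
  have hac : a - c ≠ 0 := sub_ne_zero.mpr h
  simp only [mem_sloped]
  refine ⟨((a - c)⁻¹ * (b - d), b - a * ((a - c)⁻¹ * (b - d))), ⟨sub_add_cancel _ _, ?_⟩, ?_⟩
  · have := mul_inv_cancel_left (a - c) (b - d) hac
    rw [sub_mul] at this
    rw [sub_add, this]
    abel
  · rintro ⟨x, y⟩ ⟨rfl, rfl⟩
    have : y + a * x - (y + c * x) = (a - c) * x := by rw [sub_mul]; abel
    simp only [this, inv_mul_cancel_left _ _ hac, add_sub_cancel_right]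

/-- Two distinct lines are either parallel and disjoint, or meet in exactly one point. -/
theorem parallel_or_meet {g h : CoordLine K} (hgh : g ≠ h) :
    (g.Parallel h ∧ ¬ ∃ p : K × K, p ∈ g ∧ p ∈ h) ∨
      (¬ g.Parallel h ∧ ∃! p : K × K, p ∈ g ∧ p ∈ h) := by
  rcases g with b | ⟨a, b⟩ <;> rcases h with d | ⟨c, d⟩
  · refine Or.inl ⟨rfl, ?_⟩
    rintro ⟨p, h₁, h₂⟩
    rw [mem_vertical] at h₁ h₂
    exact hgh (by rw [← h₁, ← h₂])
  · exact Or.inr ⟨nofun, existsUnique_mem_vertical_sloped b c d⟩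
  · refine Or.inr ⟨nofun, ?_⟩
    simpa only [and_comm] using existsUnique_mem_vertical_sloped d a b
  · by_cases hac : a = c
    · subst hac
      refine Or.inl ⟨rfl, ?_⟩
      rintro ⟨p, h₁, h₂⟩
      rw [mem_sloped] at h₁ h₂
      exact hgh (by rw [← h₁, ← h₂])
    · exact Or.inr ⟨fun e => hac (ImproperPoint.sloped.inj e),
        existsUnique_mem_sloped_sloped hac b d⟩

theorem eq_of_parallel {g h : CoordLine K} {p : K × K} (hgh : g.Parallel h) (hg : p ∈ g)
    (hh : p ∈ h) : g = h := by
  by_contra hne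
  rcases parallel_or_meet hne with ⟨-, hd⟩ | ⟨hp, -⟩
  · exact hd ⟨p, hg, hh⟩
  · exact hp hgh

theorem exists_mem_improperPoint (p : K × K) (d : ImproperPoint K) :
    ∃ g : CoordLine K, p ∈ g ∧ g.improperPoint = d := by
  rcases d with _ | a
  · exact ⟨vertical p.1, mem_vertical.mpr rfl, rfl⟩
  · exact ⟨sloped a (p.2 + a * p.1), mem_sloped.mpr rfl, rfl⟩

theorem planeIncidenceAxioms : PlaneIncidenceAxioms (K × K) (CoordLine K) where
  exists_line := by
    rintro ⟨x, y⟩ ⟨x', y'⟩ -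
    by_cases h : x = x'
    · exact ⟨vertical x, mem_vertical.mpr rfl, mem_vertical.mpr h.symm⟩
    -- The coefficient `a` solves `a(x - x') = -(y - y')`, by the right inverse law.
    · refine ⟨sloped (-((y - y') * (x - x')⁻¹)) (y + -((y - y') * (x - x')⁻¹) * x),
        mem_sloped.mpr rfl, mem_sloped.mpr ?_⟩
      have := inv_mul_cancel_right (x - x') (y - y') (sub_ne_zero.mpr h)
      rw [mul_sub, sub_eq_iff_eq_add] at this
      simp only [neg_mul, this]
      abel
  line_unique A B hAB g h hAg hBg hAh hBh := by
    by_contra hgh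
    rcases parallel_or_meet hgh with ⟨-, hd⟩ | ⟨-, hu⟩
    · exact hd ⟨A, hAg, hAh⟩
    · exact hAB (hu.unique ⟨hAg, hAh⟩ ⟨hBg, hBh⟩)
  two_points := by
    rintro (b | ⟨a, b⟩)
    · exact ⟨(b, 0), (b, 1), by simp, by simp [mem_vertical], by simp [mem_vertical]⟩
    · exact ⟨(0, b), (1, b - a), by simp, by simp [mem_sloped], by simp [mem_sloped]⟩
  three_points := by
    refine ⟨(0, 0), (1, 0), (0, 1), by simp, by simp, by simp, ?_⟩
    rintro ⟨b | ⟨a, b⟩, h₁, h₂, h₃⟩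
    · rw [mem_vertical] at h₁ h₂
      exact zero_ne_one (h₁.trans h₂.symm)
    · rw [mem_sloped] at h₁ h₃
      simp only [mul_zero, add_zero] at h₁ h₃
      exact zero_ne_one (h₁.trans h₃.symm)

theorem parallelPostulate : ParallelPostulate (K × K) (CoordLine K) := by
  intro g A hA
  obtain ⟨h, hAh, hh⟩ := exists_mem_improperPoint A g.improperPoint
  have hne : ∀ {k : CoordLine K}, A ∈ k → g ≠ k := fun hk e => hA (e ▸ hk)
  refine ⟨h, ⟨hAh, ?_⟩, ?_⟩
  · rcases parallel_or_meet (hne hAh) with ⟨-, hd⟩ | ⟨hp, -⟩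
    · exact hd
    · exact absurd hh.symm hp
  · rintro k ⟨hAk, hk⟩
    rcases parallel_or_meet (hne hAk) with ⟨hp, -⟩ | ⟨-, hu⟩
    · exact eq_of_parallel (hp.symm.trans hh.symm) hAk hAh
    · exact absurd hu.exists hk

end CoordLine

/-! ### The projective closure -/

namespace ProjLine

open CoordLine

variable {K : Type*} [AlternativeDivisionRing K]

theorem proper_mem_ordinary {p : K × K} {g : CoordLine K} :
    ProjPoint.proper p ∈ ordinary g ↔ p ∈ g := Iff.rfl

theorem improper_mem_ordinary {d : ImproperPoint K} {g : CoordLine K} :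
    ProjPoint.improper d ∈ ordinary g ↔ g.improperPoint = d := Iff.rfl

theorem proper_notMem_atInfinity (p : K × K) :
    ProjPoint.proper p ∉ (atInfinity : ProjLine K) := fun h => h

theorem improper_mem_atInfinity (d : ImproperPoint K) :
    ProjPoint.improper d ∈ (atInfinity : ProjLine K) := trivial

theorem eq_or_eq {p q : ProjPoint K} {g h : ProjLine K} (h₁ : p ∈ g) (h₂ : q ∈ g) (h₃ : p ∈ h)
    (h₄ : q ∈ h) : p = q ∨ g = h := by
  rcases g with g | _ <;> rcases h with h | _
  · rcases p with p | p <;> rcases q with q | q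
    · by_cases hpq : p = q
      · exact Or.inl (by rw [hpq])
      · exact Or.inr (by rw [planeIncidenceAxioms.line_unique p q hpq g h h₁ h₂ h₃ h₄])
    · exact Or.inr (by rw [eq_of_parallel (Eq.trans h₂ (Eq.symm h₄)) h₁ h₃])
    · exact Or.inr (by rw [eq_of_parallel (Eq.trans h₁ (Eq.symm h₃)) h₂ h₄])
    · exact Or.inl (by rw [← show _ = p from h₁, ← show _ = q from h₂])
  · rcases p with p | p
    · exact h₃.elim
    rcases q with q | q
    · exact h₄.elim
    exact Or.inl (by rw [← show _ = p from h₁, ← show _ = q from h₂])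
  · rcases p with p | p
    · exact h₁.elim
    rcases q with q | q
    · exact h₂.elim
    exact Or.inl (by rw [← show _ = p from h₃, ← show _ = q from h₄])
  · exact Or.inr rfl

theorem exists_common_point {g h : ProjLine K} (hne : g ≠ h) :
    ∃ p : ProjPoint K, p ∈ g ∧ p ∈ h := by
  rcases g with g | _ <;> rcases h with h | _
  · rcases parallel_or_meet (fun e : g = h => hne (by rw [e])) with ⟨hp, -⟩ | ⟨-, hu⟩
    · exact ⟨.improper g.improperPoint, rfl, hp.symm⟩
    · obtain ⟨p, hp, -⟩ := hu
      exact ⟨.proper p, hp⟩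
  · exact ⟨.improper g.improperPoint, rfl, trivial⟩
  · exact ⟨.improper h.improperPoint, trivial, rfl⟩
  · exact absurd rfl hne

theorem exists_line_through {p q : ProjPoint K} (hne : p ≠ q) :
    ∃ g : ProjLine K, p ∈ g ∧ q ∈ g := by
  rcases p with p | p <;> rcases q with q | q
  · obtain ⟨g, hg⟩ := planeIncidenceAxioms.exists_line p q fun e => hne (by rw [e])
    exact ⟨.ordinary g, hg⟩
  · obtain ⟨g, hg⟩ := exists_mem_improperPoint p q
    exact ⟨.ordinary g, hg⟩
  · obtain ⟨g, hg⟩ := exists_mem_improperPoint q p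
    exact ⟨.ordinary g, hg.symm⟩
  · exact ⟨.atInfinity, trivial, trivial⟩

noncomputable instance projectivePlane :
    Configuration.ProjectivePlane (ProjPoint K) (ProjLine K) where
  exists_point l := by
    rcases l with (b | ⟨a, b⟩) | _
    · exact ⟨.improper (.sloped 0), nofun⟩
    · exact ⟨.improper .vertical, nofun⟩
    · exact ⟨.proper 0, proper_notMem_atInfinity 0⟩
  exists_line p := by
    rcases p with p | (_ | a)
    · exact ⟨.atInfinity, proper_notMem_atInfinity p⟩
    · exact ⟨.ordinary (.sloped 0 0), nofun⟩
    · exact ⟨.ordinary (.vertical 0), nofun⟩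
  eq_or_eq := eq_or_eq
  mkPoint h := (exists_common_point h).choose
  mkPoint_ax h := (exists_common_point h).choose_spec
  mkLine h := (exists_line_through h).choose
  mkLine_ax h := (exists_line_through h).choose_spec
  exists_config := by
    refine ⟨.proper 0, .improper .vertical, .improper (.sloped 0), .ordinary (.sloped 1 0),
      .atInfinity, .ordinary (.vertical 1), proper_notMem_atInfinity 0, ?_, nofun, trivial, rfl,
      ?_, trivial, nofun⟩
    · rw [proper_mem_ordinary, mem_vertical]
      exact zero_ne_one
    · rw [improper_mem_ordinary]
      exact fun e => one_ne_zero (ImproperPoint.sloped.inj e)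

end ProjLine

/-! ### Collineations of the projective closure -/

namespace ProjLine

open CoordLine

variable {K : Type*} [AlternativeDivisionRing K]

/-- The action of `(x, y) ↦ (x + s, y + m x + t)` on points. -/
def affinePoint (s m t : K) : ProjPoint K → ProjPoint K
  | .proper (x, y) => .proper (x + s, y + m * x + t)
  | .improper .vertical => .improper .vertical
  -- The minus sign appears because `sloped a b` is `y = -ax + b`.
  | .improper (.sloped a) => .improper (.sloped (a - m))

/-- The action of `(x, y) ↦ (x + s, y + m x + t)` on lines. -/
def affineLine (s m t : K) : ProjLine K → ProjLine K
  | .ordinary (.vertical b) => .ordinary (.vertical (b + s))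
  | .ordinary (.sloped a b) => .ordinary (.sloped (a - m) (b + t + (a - m) * s))
  | .atInfinity => .atInfinity

theorem affinePoint_affinePoint (s m t : K) (p : ProjPoint K) :
    affinePoint (-s) (-m) (m * s - t) (affinePoint s m t p) = p := by
  rcases p with ⟨x, y⟩ | (_ | a)
  · simp only [affinePoint, ProjPoint.proper.injEq, Prod.mk.injEq]
    refine ⟨by abel, ?_⟩
    rw [mul_add, neg_mul, neg_mul]
    abel
  · rfl
  · simp [affinePoint]

theorem affineLine_affineLine (s m t : K) (l : ProjLine K) :
    affineLine (-s) (-m) (m * s - t) (affineLine s m t l) = l := by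
  rcases l with (b | ⟨a, b⟩) | _
  · simp [affineLine]
  · simp only [affineLine, ProjLine.ordinary.injEq, CoordLine.sloped.injEq]
    refine ⟨by abel, ?_⟩
    simp only [sub_mul, mul_neg, sub_neg_eq_add, add_mul, neg_add, neg_sub]
    abel
  · rfl

/-- The collineation `(x, y) ↦ (x + s, y + m x + t)`. -/
def affine (s m t : K) : Collineation (ProjPoint K) (ProjLine K) where
  point :=
    { toFun := affinePoint s m t
      invFun := affinePoint (-s) (-m) (m * s - t)
      left_inv := affinePoint_affinePoint s m t
      right_inv := fun p => by
        simpa using affinePoint_affinePoint (-s) (-m) (m * s - t) p }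
  line :=
    { toFun := affineLine s m t
      invFun := affineLine (-s) (-m) (m * s - t)
      left_inv := affineLine_affineLine s m t
      right_inv := fun l => by
        simpa using affineLine_affineLine (-s) (-m) (m * s - t) l }
  mem_iff p l := by
    change affinePoint s m t p ∈ affineLine s m t l ↔ p ∈ l
    rcases p with ⟨x, y⟩ | (_ | c) <;> rcases l with (b | ⟨a, b⟩) | _
    · simp [affinePoint, affineLine, proper_mem_ordinary, mem_vertical]
    · simp only [affinePoint, affineLine, proper_mem_ordinary, mem_sloped]
      rw [← sub_eq_zero, ← sub_eq_zero (a := y + a * x)]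
      simp only [mul_add, sub_mul]
      refine Eq.congr_left ?_
      abel
    · exact Iff.rfl
    · exact Iff.rfl
    · simp [affinePoint, affineLine, improper_mem_ordinary, CoordLine.improperPoint]
    · exact Iff.rfl
    · simp [affinePoint, affineLine, improper_mem_ordinary, CoordLine.improperPoint]
    · simp [affinePoint, affineLine, improper_mem_ordinary, CoordLine.improperPoint]
    · exact Iff.rfl

open Classical in
/-- The action of `(x, y) ↦ (y, x)` on points. -/
noncomputable def swapPoint : ProjPoint K → ProjPoint K
  | .proper (x, y) => .proper (y, x)
  | .improper .vertical => .improper (.sloped 0)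
  | .improper (.sloped a) => if a = 0 then .improper .vertical else .improper (.sloped a⁻¹)

open Classical in
/-- The action of `(x, y) ↦ (y, x)` on lines. -/
noncomputable def swapLine : ProjLine K → ProjLine K
  | .ordinary (.vertical b) => .ordinary (.sloped 0 b)
  | .ordinary (.sloped a b) =>
    if a = 0 then .ordinary (.vertical b) else .ordinary (.sloped a⁻¹ (a⁻¹ * b))
  | .atInfinity => .atInfinity

/-- The collineation `(x, y) ↦ (y, x)`. -/
noncomputable def swap : Collineation (ProjPoint K) (ProjLine K) :=
  .ofInvolutive swapPoint swapLine
    (by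
      rintro (⟨x, y⟩ | (_ | a))
      · rfl
      · simp [swapPoint]
      · by_cases ha : a = 0
        · simp [swapPoint, ha]
        · simp [swapPoint, ha, inv_ne_zero_of_ne_zero ha, inv_inv_of_ne_zero ha])
    (by
      rintro ((b | ⟨a, b⟩) | _)
      · simp [swapLine]
      · by_cases ha : a = 0
        · simp [swapLine, ha]
        · simp [swapLine, ha, inv_ne_zero_of_ne_zero ha, inv_inv_of_ne_zero ha,
            mul_inv_cancel_left a b ha]
      · rfl)
    (by
      rintro (⟨x, y⟩ | (_ | c)) ((b | ⟨a, b⟩) | _) h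
      · simpa [swapPoint, swapLine, proper_mem_ordinary, mem_vertical, mem_sloped] using h
      · rw [proper_mem_ordinary, mem_sloped] at h
        by_cases ha : a = 0
        · simpa [swapPoint, swapLine, ha, proper_mem_ordinary, mem_vertical] using h
        · simp only [swapPoint, swapLine, ha, if_false, proper_mem_ordinary, mem_sloped]
          -- Left multiplication of `y + ax = b` by `a⁻¹`.
          rw [← h, mul_add, inv_mul_cancel_left a x ha, add_comm]
      · exact h
      · rfl
      · exact absurd h nofun
      · trivial
      · exact absurd h nofun
      · obtain rfl : a = c := ImproperPoint.sloped.inj h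
        by_cases ha : a = 0 <;>
          simp [swapPoint, swapLine, ha, improper_mem_ordinary, CoordLine.improperPoint]
      · by_cases hc : c = 0 <;> simp [swapPoint, swapLine, hc, improper_mem_atInfinity])

theorem swap_point (p : ProjPoint K) : swap.point p = swapPoint p := rfl

theorem swap_line (l : ProjLine K) : swap.line l = swapLine l := rfl

open Classical in
/-- The action of `(x, y) ↦ (x⁻¹, y x⁻¹)` on points. -/
noncomputable def inversionPoint : ProjPoint K → ProjPoint K
  -- The line `x = 0` is exchanged with the line at infinity. The signs are forced by `y + ax = b`
  -- going to `y - bx = -a`.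
  | .proper (x, y) => if x = 0 then .improper (.sloped (-y)) else .proper (x⁻¹, y * x⁻¹)
  | .improper .vertical => .improper .vertical
  | .improper (.sloped a) => .proper (0, -a)

open Classical in
/-- The action of `(x, y) ↦ (x⁻¹, y x⁻¹)` on lines. -/
noncomputable def inversionLine : ProjLine K → ProjLine K
  | .ordinary (.vertical b) => if b = 0 then .atInfinity else .ordinary (.vertical b⁻¹)
  | .ordinary (.sloped a b) => .ordinary (.sloped (-b) (-a))
  | .atInfinity => .ordinary (.vertical 0)

/-- The collineation `(x, y) ↦ (x⁻¹, y x⁻¹)`. -/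
noncomputable def inversion : Collineation (ProjPoint K) (ProjLine K) :=
  .ofInvolutive inversionPoint inversionLine
    (by
      rintro (⟨x, y⟩ | (_ | a))
      · by_cases hx : x = 0
        · simp [inversionPoint, hx]
        · simp [inversionPoint, hx, inv_ne_zero_of_ne_zero hx, inv_inv_of_ne_zero hx,
            inv_mul_cancel_right x y hx]
      · rfl
      · simp [inversionPoint])
    (by
      rintro ((b | ⟨a, b⟩) | _)
      · by_cases hb : b = 0
        · simp [inversionLine, hb]
        · simp [inversionLine, hb, inv_ne_zero_of_ne_zero hb, inv_inv_of_ne_zero hb]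
      · simp [inversionLine]
      · simp [inversionLine])
    (by
      rintro (⟨x, y⟩ | (_ | c)) ((b | ⟨a, b⟩) | _) h
      · obtain rfl : x = b := mem_vertical.mp h
        by_cases hx : x = 0
        · simp [inversionPoint, inversionLine, hx, improper_mem_atInfinity]
        · simp [inversionPoint, inversionLine, hx, proper_mem_ordinary, mem_vertical]
      · rw [proper_mem_ordinary, mem_sloped] at h
        simp only at h
        by_cases hx : x = 0
        · simp only [hx, mul_zero, add_zero] at h
          simp [inversionPoint, inversionLine, hx, h, improper_mem_ordinary,
            CoordLine.improperPoint]
        · simp only [inversionPoint, inversionLine, hx, if_false, proper_mem_ordinary, mem_sloped]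
          -- Right multiplication of `y + ax = b` by `x⁻¹`.
          rw [← h, neg_mul, add_mul, mul_inv_cancel_right x a hx]
          abel
      · exact h.elim
      · by_cases hb : b = 0
        · simp [inversionPoint, inversionLine, hb, improper_mem_atInfinity]
        · simp [inversionPoint, inversionLine, hb, improper_mem_ordinary,
            CoordLine.improperPoint]
      · exact absurd h nofun
      · rfl
      · exact absurd h nofun
      · obtain rfl : a = c := ImproperPoint.sloped.inj h
        simp [inversionPoint, inversionLine, proper_mem_ordinary, mem_sloped]
      · simp [inversionPoint, inversionLine, proper_mem_ordinary, mem_vertical])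

theorem inversion_line (l : ProjLine K) : inversion.line l = inversionLine l := rfl

/-! ### Elations for every flag -/

theorem hasElations_vertical_atInfinity :
    HasElations (.improper .vertical : ProjPoint K) (.atInfinity : ProjLine K) := by
  rintro (⟨x, y⟩ | d) (⟨x', y'⟩ | d') ((b | ⟨a, b⟩) | _) hA hA' hO hAc hAc'
  · obtain rfl : x = b := mem_vertical.mp hAc
    obtain rfl : x' = x := mem_vertical.mp hAc'
    refine ⟨affine 0 0 (y' - y), ?_, ?_, ?_⟩
    · rintro (⟨x, y⟩ | (_ | a)) hX
      · exact hX.elim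
      · rfl
      · simp [affine, affinePoint]
    · rintro ((b | ⟨a, b⟩) | _) hg
      · simp [affine, affineLine]
      · exact absurd hg nofun
      · rfl
    · simp [affine, affinePoint]
  · exact absurd hO nofun
  · exact hAc.elim
  all_goals first | exact absurd trivial hA | exact absurd trivial hA'

theorem hasElations_atInfinity {O : ProjPoint K} (hO : O ∈ (.atInfinity : ProjLine K)) :
    HasElations O (.atInfinity : ProjLine K) := by
  rcases O with p | (_ | a)
  · exact hO.elim
  · exact hasElations_vertical_atInfinity
  -- The shear takes direction `a` to direction `0`, and the swap takes that to the vertical one.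
  · refine .of_map (affine 0 a 0) (.of_map swap ?_)
    have : swap.point ((affine 0 a 0).point (.improper (.sloped a))) =
        (.improper .vertical : ProjPoint K) := by
      simp [swap_point, affine, affinePoint, swapPoint]
    rw [this]
    exact hasElations_vertical_atInfinity

/-- Translate the line to `x = 0`, which the inversion exchanges with the line at infinity. -/
theorem hasElations_vertical (b : K) {O : ProjPoint K} (hO : O ∈ ordinary (.vertical b)) :
    HasElations O (ordinary (.vertical b)) := by
  refine .of_map ((affine (-b) 0 0).trans inversion) ?_
  have : ((affine (-b) 0 0).trans inversion).line (ordinary (.vertical b)) = .atInfinity := by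
    simp [Collineation.trans, inversion_line, affine, affineLine, inversionLine]
  have h := ((affine (-b) 0 0).trans inversion).mem hO
  rw [this] at h ⊢
  exact hasElations_atInfinity h

/-- The projective closure has all elations. -/
theorem hasElations {O : ProjPoint K} {s : ProjLine K} (hO : O ∈ s) : HasElations O s := by
  rcases s with (b | ⟨a, b⟩) | _
  · exact hasElations_vertical b hO
  · refine .of_map ((affine 0 a 0).trans swap) ?_
    have : ((affine 0 a 0).trans swap).line (ordinary (.sloped a b)) =
        ordinary (.vertical b) := by
      simp [Collineation.trans, swap_line, affine, affineLine, swapLine]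
    have h := ((affine 0 a 0).trans swap).mem hO
    rw [this] at h ⊢
    exact hasElations_vertical b h
  · exact hasElations_atInfinity hO

theorem desarguesD2 : DesarguesD2 (ProjPoint K) (ProjLine K) :=
  desarguesD2_of_hasElations fun _ _ => hasElations

end ProjLine

/-! ### Failure of the general theorem of Desargues -/

section Counterexample

open ProjLine CoordLine
open scoped Quaternion

namespace CayleyNumber

/-- A triangle of the projective closure given by three proper points and three ordinary lines. -/
def properTriangle (A : Fin 3 → CayleyNumber × CayleyNumber) (a : Fin 3 → CoordLine CayleyNumber)
    (h₁ : ∀ i j, i ≠ j → A i ∈ a j) (h₂ : ∀ i, A i ∉ a i) :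
    Triangle (ProjPoint CayleyNumber) (ProjLine CayleyNumber) where
  vertex i := .proper (A i)
  side i := .ordinary (a i)
  vertex_mem_side := h₁
  vertex_notMem_side := h₂

/-- The slope of the third connecting line. -/
noncomputable def connectorSlope : CayleyNumber := e₁ * e₂ - e₁

/-- The first of two triangles in perspective from `(0, 0)` that are not axial. -/
noncomputable def perspectiveTriangle :
    Triangle (ProjPoint CayleyNumber) (ProjLine CayleyNumber) :=
  -- The slope `m = e₁e₂ - e₁` of the third connector is chosen so that the parallel to `y + (e₁e₂)x
  -- = 0` through `(u, 0)` meets it where `e₁x = (e₁e₂)u`. For `u = 1` this is `x = e₂`.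
  properTriangle ![(1, 0), (0, e₂), (e₂, -(connectorSlope * e₂))]
    ![.sloped (1 + connectorSlope) e₂, .sloped (e₁ * e₂) (e₁ * e₂), .sloped e₂ e₂]
    (by
      intro i j hij
      fin_cases i <;> fin_cases j <;> first | exact absurd rfl hij | skip
      all_goals
        simp only [connectorSlope, Fin.zero_eta, Fin.mk_one, Fin.reduceFinMk,
          Matrix.cons_val_zero, Matrix.cons_val_one, Matrix.cons_val, mem_sloped]
        simp only [mul_one, mul_zero, zero_add, add_zero, sub_mul, add_mul, one_mul]
        try abel)
    (by
      intro i
      fin_cases i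
      all_goals
        simp only [connectorSlope, Fin.zero_eta, Fin.mk_one, Fin.reduceFinMk,
          Matrix.cons_val_zero, Matrix.cons_val_one, Matrix.cons_val, mem_sloped]
        intro h
      · have := congrArg (fun a => a.fst.re) h
        simp at this
      · have := congrArg (fun a => a.fst.imJ) h
        simp at this
      · have := congrArg (fun a => a.fst.re) h
        simp at this)

/-- The second of two triangles in perspective from `(0, 0)` that are not axial. -/
noncomputable def perspectiveTriangle' :
    Triangle (ProjPoint CayleyNumber) (ProjLine CayleyNumber) :=
  -- The same construction with `u = e`. Associativity would give `x = e₂e` and a third pair of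
  -- parallel sides; here `x = -(e₂e)`, and the coefficients become `m + 1` and `m - 1`.
  properTriangle ![(e, 0), (0, e₂ * e), (-(e₂ * e), connectorSlope * (e₂ * e))]
    ![.sloped (connectorSlope - 1) (e₂ * e), .sloped (e₁ * e₂) (e₁ * e₂ * e),
      .sloped e₂ (e₂ * e)]
    (by
      intro i j hij
      fin_cases i <;> fin_cases j <;> first | exact absurd rfl hij | skip
      all_goals
        simp only [connectorSlope, Fin.zero_eta, Fin.mk_one, Fin.reduceFinMk,
          Matrix.cons_val_zero, Matrix.cons_val_one, Matrix.cons_val, mem_sloped]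
        simp only [mul_zero, zero_add, add_zero, sub_mul, one_mul, mul_neg, e₁_mul_e₂_mul_e]
        try abel)
    (by
      intro i
      fin_cases i
      all_goals
        simp only [connectorSlope, Fin.zero_eta, Fin.mk_one, Fin.reduceFinMk,
          Matrix.cons_val_zero, Matrix.cons_val_one, Matrix.cons_val, mem_sloped]
        intro h
      · have := congrArg (fun a => a.snd.re) h
        simp at this
      · have := congrArg (fun a => a.snd.imJ) h
        simp at this
      · have := congrArg (fun a => a.snd.re) h
        simp at this)

theorem admissible_perspectiveTriangle :
    perspectiveTriangle.Admissible perspectiveTriangle' := by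
  have h₁ : (1 : CayleyNumber) ≠ e := fun h => by simpa using congrArg (fun a => a.fst.re) h
  have h₂ : e₂ ≠ e₂ * e := fun h => by simpa using congrArg (fun a => a.fst.imJ) h
  have h₃ : e₂ ≠ -(e₂ * e) := fun h => by simpa using congrArg (fun a => a.fst.imJ) h
  have h₄ : e₁ * e₂ ≠ e₁ * e₂ * e := fun h => by simpa using congrArg (fun a => a.fst.imK) h
  have h₅ : 1 + connectorSlope ≠ connectorSlope - 1 := fun h => by
    have := congrArg (fun a => a.fst.re) h
    simp [connectorSlope] at this
    norm_num at this
  intro i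
  fin_cases i <;>
    simp [perspectiveTriangle, perspectiveTriangle', properTriangle, h₁, h₂, h₃, h₄, h₅]

theorem perspective_perspectiveTriangle :
    perspectiveTriangle.Perspective perspectiveTriangle' := by
  refine ⟨.proper (0, 0), fun i => ?_⟩
  have key : ∀ (l : CoordLine CayleyNumber) (A B : CayleyNumber × CayleyNumber),
      A ∈ l → B ∈ l → (0, 0) ∈ l → ∃ h : ProjLine CayleyNumber,
        ProjPoint.proper A ∈ h ∧ ProjPoint.proper B ∈ h ∧ ProjPoint.proper (0, 0) ∈ h :=
    fun l A B h₁ h₂ h₃ => ⟨.ordinary l, h₁, h₂, h₃⟩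
  fin_cases i
  · exact key (.sloped 0 0) (1, 0) (e, 0) (by simp [mem_sloped]) (by simp [mem_sloped])
      (by simp [mem_sloped])
  · exact key (.vertical 0) (0, e₂) (0, e₂ * e) (by simp [mem_vertical]) (by simp [mem_vertical])
      (by simp [mem_vertical])
  · exact key (.sloped connectorSlope 0) (e₂, -(connectorSlope * e₂))
      (-(e₂ * e), connectorSlope * (e₂ * e)) (by simp [mem_sloped]) (by simp [mem_sloped])
      (by simp [mem_sloped])

theorem eq_improper_of_mem_of_mem {a b d : CayleyNumber} (hbd : b ≠ d)
    {Q : ProjPoint CayleyNumber} (h₁ : Q ∈ ordinary (.sloped a b))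
    (h₂ : Q ∈ ordinary (.sloped a d)) : Q = .improper (.sloped a) := by
  rcases Q with p | p
  · exact absurd ((mem_sloped.mp h₁).symm.trans (mem_sloped.mp h₂)) hbd
  · rw [← show _ = p from h₁]
    rfl

/-- Two pairs of sides are parallel with different directions, so the axis could only be the line at
infinity. The third pair is not parallel and meets at a proper point. -/
theorem not_axial_perspectiveTriangle :
    ¬ perspectiveTriangle.Axial perspectiveTriangle' := by
  rintro ⟨s, hs⟩
  obtain ⟨Q₀, h₀, h₀', hs₀⟩ := hs 0
  obtain ⟨Q₁, h₁, h₁', hs₁⟩ := hs 1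
  obtain ⟨Q₂, h₂, h₂', hs₂⟩ := hs 2
  have hne₁ : e₁ * e₂ ≠ e₁ * e₂ * e := fun h => by simpa using congrArg (fun a => a.fst.imK) h
  have hne₂ : e₂ ≠ e₂ * e := fun h => by simpa using congrArg (fun a => a.fst.imJ) h
  obtain rfl := eq_improper_of_mem_of_mem hne₁ h₁ h₁'
  obtain rfl := eq_improper_of_mem_of_mem hne₂ h₂ h₂'
  rcases s with s | _
  · have := congrArg (fun a => a.fst.imJ)
      (ImproperPoint.sloped.inj ((show _ = _ from hs₁).symm.trans hs₂))
    simp at this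
  · rcases Q₀ with p | d
    · exact hs₀
    · have := congrArg (fun a => a.fst.re)
        (ImproperPoint.sloped.inj ((show _ = d from h₀).trans (show _ = d from h₀').symm))
      simp [connectorSlope] at this
      norm_num at this

theorem not_desarguesD0 : ¬ DesarguesD0 (ProjPoint CayleyNumber) (ProjLine CayleyNumber) :=
  fun h => not_axial_perspectiveTriangle
    ((h _ _ admissible_perspectiveTriangle).mp perspective_perspectiveTriangle)

end CayleyNumber

end Counterexample

theorem mainTheorem9 :
    -- the Cayley numbers form an alternative field
    IsAlternativeField CayleyNumber ∧
    -- the norm and the norm theorem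
    (∀ a : CayleyNumber, a * a.conj = CayleyNumber.ofReal a.N ∧
      a.conj * a = CayleyNumber.ofReal a.N) ∧
    (∀ a b : CayleyNumber, (a * b).N = a.N * b.N) ∧
    -- inverses and the special associative law
    (∀ a : CayleyNumber, a ≠ 0 → a * a⁻¹ = 1 ∧ a⁻¹ * a = 1) ∧
    (∀ a b : CayleyNumber, a ≠ 0 → a⁻¹ * (a * b) = b ∧ a * (a⁻¹ * b) = b ∧
      (b * a) * a⁻¹ = b ∧ (b * a⁻¹) * a = b) ∧
    -- the multiplication is not associative
    (CayleyNumber.e₁ * CayleyNumber.e₂) * CayleyNumber.e ≠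
      CayleyNumber.e₁ * (CayleyNumber.e₂ * CayleyNumber.e) ∧
    -- the coordinate plane satisfies the plane incidence axioms and the parallel postulate
    PlaneIncidenceAxioms (CayleyNumber × CayleyNumber) (CoordLine CayleyNumber) ∧
    ParallelPostulate (CayleyNumber × CayleyNumber) (CoordLine CayleyNumber) ∧
    (∀ g h : CoordLine CayleyNumber, g ≠ h →
      (g.Parallel h ∧ ¬ ∃ p : CayleyNumber × CayleyNumber, p ∈ g ∧ p ∈ h) ∨
      (¬ g.Parallel h ∧ ∃! p : CayleyNumber × CayleyNumber, p ∈ g ∧ p ∈ h)) ∧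
    -- its projective closure is a projective plane in which `D₂` holds and `D₀` fails
    Nonempty (Configuration.ProjectivePlane (ProjPoint CayleyNumber) (ProjLine CayleyNumber)) ∧
    DesarguesD2 (ProjPoint CayleyNumber) (ProjLine CayleyNumber) ∧
    ¬ DesarguesD0 (ProjPoint CayleyNumber) (ProjLine CayleyNumber) :=
  ⟨CayleyNumber.isAlternativeField,
    fun a => ⟨CayleyNumber.mul_conj_self a, CayleyNumber.conj_mul_self a⟩,
    CayleyNumber.N_mul,
    fun _ ha => ⟨AlternativeDivisionRing.mul_inv_self ha, AlternativeDivisionRing.inv_mul_self ha⟩,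
    fun a b ha => ⟨AlternativeDivisionRing.inv_mul_cancel_left a b ha,
      AlternativeDivisionRing.mul_inv_cancel_left a b ha,
      AlternativeDivisionRing.mul_inv_cancel_right a b ha,
      AlternativeDivisionRing.inv_mul_cancel_right a b ha⟩,
    CayleyNumber.e₁_mul_e₂_mul_e_ne,
    CoordLine.planeIncidenceAxioms,
    CoordLine.parallelPostulate,
    fun _ _ => CoordLine.parallel_or_meet,
    ⟨ProjLine.projectivePlane⟩,
    ProjLine.desarguesD2,
    CayleyNumber.not_desarguesD0⟩
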